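/- Let $H\subseteq\mathbb R$ be an additive subgroup (possibly $0$). Let $H_\vee=H\sqcup\{-\infty\}$ be the semifield whose addition is $\max$ (written $\vee$, with neutral element $-\infty$) and whose multiplication is the addition of $H$ (with $-\infty$ absorbing); $H_\vee$-modules are semimodules over it. *Extended polyhedra.* Let $I$ be a finite set, and let $\Delta\subseteq H^I$ be an $H$-integral general linear weight polyhedron: a non-empty intersection of finitely many half-spaces $x_i-x_j\le c$ with $i\ne j$ in $I$ and $c\in H$. The corresponding extended weight polyhedron is the set $\bar\Delta\subseteq H_\vee^I$ of all solutions in $H_\vee^I$ of the inequalities $x_i\le x_j+c$ that define $\Delta$. The case $I=\emptyset$ is allowed and gives the one-point polyhedron $\{-\infty\}$. *Functions and maps.* An affine function whose linear part is a fundamental weight is a function of the form $x\mapsto x_i+c$ with $i\in I$, $c\in H$. A convex, piecewise-affine function whose linear parts are fundamental weights is a function with values in $H_\vee$ that is a maximum of finitely many of these (the empty maximum is $-\infty$). Let $\mathrm{Poly}^{\mathrm{GL}}_{H,\vee}$ be the category of extended weight polyhedra, a morphism $\bar\Delta_1\to\bar\Delta_2$ being a map all of whose co-ordinates are functions of this kind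 on $\bar\Delta_1$. Write $\mathrm{Aff}(\bar\Delta)\subseteq \mathrm{CPA}(\bar\Delta)$ for the sets of affine, respectively convex piecewise-affine, functions on $\bar\Delta$ whose linear parts are fundamental weights, ordered pointwise. Then: 1. The functor $\bar\Delta\mapsto\mathrm{CPA}(\bar\Delta)$, with pullback of functions, is an anti-equivalence from $\mathrm{Poly}^{\mathrm{GL}}_{H,\vee}$ to the category of finite (i.e. finitely generated) projective $H_\vee$-modules. 2. Dually, every $\bar\Delta$ is an $H_\vee$-submodule of $H_\vee^I$, and $\bar\Delta\mapsto\bar\Delta$ is an equivalence from $\mathrm{Poly}^{\mathrm{GL}}_{H,\vee}$ to the category of finite projective $H_\vee$-modules. 3. These are the extension, linear with respect to $\vee$, of the duality $\bar\Delta\mapsto\mathrm{Aff}(\bar\Delta)$ between weight polyhedra and partially ordered $H$-modules, in the following sense. (a) $\mathrm{CPA}(\bar\Delta)$ is the free $H_\vee$-module on the partially ordered $H$-module $\mathrm{Aff}(\bar\Delta)$: every monotone $H$-equivariant map from $\mathrm{Aff}(\bar\Delta)$ to an $H_\vee$-module $X$ (ordered by $a\le b\Leftrightarrow a\vee b=b$)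 extends uniquely to an $H_\vee$-linear map $\mathrm{CPA}(\bar\Delta)\to X$. (b) Every morphism $\bar\Delta_1\to\bar\Delta_2$ is the pointwise maximum of finitely many affine maps from $\bar\Delta_1$ into strata of $\bar\Delta_2$, that is, of morphisms each of whose co-ordinates is either constantly $-\infty$ or an affine function whose linear part is a fundamental weight. (c) Both functors take pointwise maxima of morphisms to sums of linear maps, and the constant morphism $-\infty$ to the zero map. 4. If $H\ne0$, let $\Delta=\bar\Delta_1\cap H^{I_1}$. Every map $\Delta\to\bar\Delta_2$ whose co-ordinates are convex, piecewise-affine functions on $\Delta$ whose linear parts are fundamental weights extends uniquely to a morphism $\bar\Delta_1\to\bar\Delta_2$. -/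

import Mathlib

open CategoryTheory

universe u

noncomputable section

/-- The max-plus semifield `H_∨ = H ⊔ {-∞}` of an additive subgroup `H ⊆ ℝ`.
The bottom element `⊥` is `-∞`. -/
def HVee (H : AddSubgroup ℝ) : Type := WithBot H

namespace HVee

variable {H : AddSubgroup ℝ}

instance : LinearOrder (HVee H) := inferInstanceAs (LinearOrder (WithBot H))
instance : OrderBot (HVee H) := inferInstanceAs (OrderBot (WithBot H))

/-- The inclusion `H ⊆ H_∨`. -/
def of (c : H) : HVee H := (WithBot.some c : WithBot H)

/-- Addition in `H_∨` is the maximum. -/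
instance : Add (HVee H) := ⟨fun x y => x ⊔ y⟩

/-- The zero of `H_∨` is `-∞`. -/
instance : Zero (HVee H) := ⟨⊥⟩

/-- Multiplication in `H_∨` is the addition of `H`, extended so that `-∞` is absorbing. -/
instance : Mul (HVee H) := ⟨fun (x y : WithBot H) => x + y⟩

/-- The one of `H_∨` is `0 ∈ H`. -/
instance : One (HVee H) := ⟨of 0⟩

theorem mul_mono_right (a : HVee H) {b c : HVee H} (h : b ≤ c) : a * b ≤ a * c := by
  induction a using WithBot.recBotCoe with
  | bot => exact le_of_eq ((WithBot.bot_add (b : WithBot H)).trans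
      (WithBot.bot_add (c : WithBot H)).symm)
  | coe a =>
    induction b using WithBot.recBotCoe with
    | bot => exact le_of_eq_of_le (WithBot.add_bot (a : WithBot H)) (bot_le (α := WithBot H))
    | coe b =>
      induction c using WithBot.recBotCoe with
      | bot => exact absurd h (WithBot.not_coe_le_bot b)
      | coe c => exact WithBot.coe_le_coe.2 (add_le_add_right (WithBot.coe_le_coe.1 h) a)

theorem mul_comm_aux (a b : HVee H) : a * b = b * a := add_comm (G := WithBot H) a b

theorem left_distrib_aux (a b c : HVee H) : a * (b + c) = a * b + a * c := by
  rcases le_total b c with h | h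
  · exact (congrArg (a * ·) (sup_of_le_right h)).trans (sup_of_le_right (mul_mono_right a h)).symm
  · exact (congrArg (a * ·) (sup_of_le_left h)).trans (sup_of_le_left (mul_mono_right a h)).symm

instance : CommSemiring (HVee H) where
  add_assoc := sup_assoc
  zero_add := bot_sup_eq
  add_zero := sup_bot_eq
  add_comm := sup_comm
  nsmul := nsmulRec
  mul_assoc := add_assoc (G := WithBot H)
  one_mul := zero_add (M := WithBot H)
  mul_one := add_zero (M := WithBot H)
  mul_comm := mul_comm_aux
  zero_mul := WithBot.bot_add (α := H)
  mul_zero := WithBot.add_bot (α := H)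
  left_distrib := left_distrib_aux
  right_distrib a b c := by rw [mul_comm_aux, left_distrib_aux, mul_comm_aux c a, mul_comm_aux c b]

theorem add_def (x y : HVee H) : x + y = x ⊔ y := rfl

theorem zero_def : (0 : HVee H) = ⊥ := rfl

theorem one_def : (1 : HVee H) = of 0 := rfl

theorem of_mul_of (a b : H) : of a * of b = of (a + b) := rfl

theorem bot_mul (x : HVee H) : ⊥ * x = ⊥ := zero_mul x

theorem of_add (a b : H) : of (a + b) = of a * of b := WithBot.coe_add a b

theorem of_le_of {a b : H} : of a ≤ of b ↔ a ≤ b := WithBot.coe_le_coe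

theorem of_ne_bot (a : H) : of a ≠ ⊥ := WithBot.coe_ne_bot

theorem eq_bot_or_of (x : HVee H) : x = ⊥ ∨ ∃ a : H, x = of a := by
  induction x using WithBot.recBotCoe with
  | bot => exact Or.inl rfl
  | coe a => exact Or.inr ⟨a, rfl⟩

theorem sup_eq_sum {α : Type*} (S : Finset α) (g : α → HVee H) : S.sup g = ∑ s ∈ S, g s := by
  classical
  induction S using Finset.induction_on with
  | empty => rfl
  | insert a s ha ih => rw [Finset.sup_insert, Finset.sum_insert ha, ih, add_def]

end HVee

variable {H : AddSubgroup ℝ}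

/-- A half-space `x i - x j ≤ c` orthogonal to a root of the general linear group `GL_ι`, with
co-ordinate `c` in `H`. The fundamental weights are the co-ordinates, the roots are the differences
of two distinct fundamental weights. -/
structure RootHalfSpace (H : AddSubgroup ℝ) (ι : Type) where
  i : ι
  j : ι
  ne : i ≠ j
  c : H

/-- The half-space as a subset of the `H`-affine space `N = H ^ ι`. -/
def RootHalfSpace.set {ι : Type} (r : RootHalfSpace H ι) : Set (ι → H) :=
  {x | x r.i - x r.j ≤ r.c}

/-- The inequality `x i ≤ x j + c` extended to the completion `(H_∨) ^ ι` of `H ^ ι`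
(the multiplication of `H_∨` is the addition of `H`). -/
def RootHalfSpace.extSet {ι : Type} (r : RootHalfSpace H ι) : Set (ι → HVee H) :=
  {x | x r.i ≤ HVee.of r.c * x r.j}

/-- An extended `H`-integral general linear weight polyhedron: a finite family of half-spaces
orthogonal to roots, with non-empty intersection in `H ^ ι` (a weight polyhedron `Δ`), gives the
extended polyhedron cut out by the same inequalities in `(H_∨) ^ ι`.
For `ι` empty this is the one-point polyhedron `{-∞}`. -/
structure ExtWeightPolyhedron (H : AddSubgroup ℝ) : Type 1 where
  /-- the finite set of fundamental weights -/
  ι : Type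
  [finite_ι : Finite ι]
  carrier : Set (ι → HVee H)
  exists_halfSpaces : ∃ R : Finset (RootHalfSpace H ι),
    (⋂ r ∈ R, r.set).Nonempty ∧ carrier = ⋂ r ∈ R, r.extSet

/-- A function on a set of points of `(H_∨) ^ ι` is fundamental affine if it is an affine function
whose linear part is a fundamental weight. -/
def IsFundAffine {ι : Type} {D : Set (ι → HVee H)} (f : D → HVee H) : Prop :=
  ∃ (i : ι) (c : H), ∀ x : D, f x = HVee.of c * x.1 i

/-- A convex, piecewise-affine function whose linear parts are fundamental weights: a maximum of
finitely many affine functions `x i + c`. The empty maximum is the constant `-∞`. -/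
def IsCPA {ι : Type} {D : Set (ι → HVee H)} (f : D → HVee H) : Prop :=
  ∃ S : Finset (ι × H), ∀ x : D, f x = S.sup fun s => HVee.of s.2 * x.1 s.1

namespace IsCPA

variable {ι κ : Type} {D : Set (ι → HVee H)}

theorem coord (i : ι) : IsCPA (fun x : D => x.1 i) :=
  ⟨{(i, 0)}, fun x => by simp [← HVee.one_def]⟩

theorem bot : IsCPA (fun _ : D => (⊥ : HVee H)) := ⟨∅, fun _ => rfl⟩

theorem sup {f g : D → HVee H} (hf : IsCPA f) (hg : IsCPA g) : IsCPA (fun x => f x ⊔ g x) := by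
  classical
  obtain ⟨S, hS⟩ := hf
  obtain ⟨T, hT⟩ := hg
  exact ⟨S ∪ T, fun x => by simp only [hS, hT, Finset.sup_union]⟩

theorem mul {f : D → HVee H} (a : HVee H) (hf : IsCPA f) : IsCPA (fun x => a * f x) := by
  classical
  obtain ⟨S, hS⟩ := hf
  rcases HVee.eq_bot_or_of a with rfl | ⟨c, rfl⟩
  · exact ⟨∅, fun x => zero_mul (f x)⟩
  · refine ⟨S.image fun s => (s.1, c + s.2), fun x => ?_⟩
    simp only [hS, Finset.sup_image]
    rw [HVee.sup_eq_sum, HVee.sup_eq_sum, Finset.mul_sum]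
    simp [HVee.of_add, mul_assoc]

theorem finset_sup {α : Type*} (S : Finset α) {f : α → D → HVee H} (hf : ∀ s, IsCPA (f s)) :
    IsCPA (fun x => S.sup fun s => f s x) := by
  classical
  induction S using Finset.induction_on with
  | empty => exact bot
  | insert a s ha ih => simpa using (hf a).sup ih

theorem comp {E : Set (κ → HVee H)} {g : E → HVee H} {f : D → E} (hg : IsCPA g)
    (hf : ∀ k, IsCPA fun x => (f x).1 k) : IsCPA (fun x => g (f x)) := by
  obtain ⟨T, hT⟩ := hg
  have h := finset_sup T fun s : κ × H => (hf s.1).mul (HVee.of s.2)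
  simpa only [hT] using h

/-- A convex, piecewise-affine function commutes with maxima and translations. -/
theorem linear {f : D → HVee H} (hf : IsCPA f) (a b : HVee H) (x y z : D)
    (h : ∀ i, z.1 i = a * x.1 i + b * y.1 i) : f z = a * f x + b * f y := by
  obtain ⟨S, hS⟩ := hf
  simp only [hS, HVee.sup_eq_sum, Finset.mul_sum, h, ← Finset.sum_add_distrib]
  refine Finset.sum_congr rfl fun s _ => ?_
  ring

end IsCPA

namespace ExtWeightPolyhedron

attribute [instance] finite_ι

/-- A morphism of extended weight polyhedra: a convex, piecewise-affine map whose linear parts are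
fundamental weights, that is, one all of whose co-ordinates are such functions. -/
@[ext]
structure Hom (E F : ExtWeightPolyhedron H) where
  toFun : E.carrier → F.carrier
  isCPA : ∀ j, IsCPA fun x => (toFun x).1 j

instance : Category (ExtWeightPolyhedron H) where
  Hom E F := Hom E F
  id E := ⟨id, fun j => IsCPA.coord j⟩
  comp f g := ⟨g.toFun ∘ f.toFun, fun j => (g.isCPA j).comp f.isCPA⟩

/-- The weight polyhedron `Δ` itself: the points of the extended polyhedron that have all their
co-ordinates in `H`. -/
def finitePart (E : ExtWeightPolyhedron H) : Set (E.ι → HVee H) :=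
  {x | x ∈ E.carrier ∧ ∀ i, x i ≠ ⊥}

/-- An extended weight polyhedron is an `H_∨`-submodule of the free module `(H_∨) ^ ι`. -/
def submodule (E : ExtWeightPolyhedron H) : Submodule (HVee H) (E.ι → HVee H) where
  carrier := E.carrier
  add_mem' := by
    obtain ⟨R, -, h⟩ := E.exists_halfSpaces
    intro x y hx hy
    simp only [h, Set.mem_iInter, RootHalfSpace.extSet, Set.mem_ofPred_eq] at hx hy ⊢
    intro r hr
    rw [Pi.add_apply, Pi.add_apply, mul_add]
    exact sup_le_sup (hx r hr) (hy r hr)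
  zero_mem' := by
    obtain ⟨R, -, h⟩ := E.exists_halfSpaces
    simp only [h, Set.mem_iInter, RootHalfSpace.extSet, Set.mem_ofPred_eq]
    exact fun r _ => bot_le
  smul_mem' := by
    obtain ⟨R, -, h⟩ := E.exists_halfSpaces
    intro a x hx
    simp only [h, Set.mem_iInter, RootHalfSpace.extSet, Set.mem_ofPred_eq] at hx ⊢
    intro r hr
    rw [Pi.smul_apply, Pi.smul_apply, smul_eq_mul, smul_eq_mul, mul_left_comm]
    exact HVee.mul_mono_right a (hx r hr)

/-- A morphism of extended weight polyhedra is `H_∨`-linear. -/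
def Hom.toLinearMap {E F : ExtWeightPolyhedron H} (f : E ⟶ F) :
    E.submodule →ₗ[HVee H] F.submodule where
  toFun := f.toFun
  map_add' x y := Subtype.ext <| funext fun j => by
    simpa using! (f.isCPA j).linear 1 1 x y (x + y : E.submodule) (fun i => by
      rw [one_mul, one_mul]; rfl)
  map_smul' a x := Subtype.ext <| funext fun j => by
    simpa using! (f.isCPA j).linear a 0 x x (a • x : E.submodule) (fun i => by
      rw [zero_mul, add_zero]; rfl)

/-- The covariant functor to `H_∨`-modules: an extended weight polyhedron with its own
`H_∨`-module structure. -/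
def moduleFunctor (H : AddSubgroup ℝ) : ExtWeightPolyhedron H ⥤ SemimoduleCat.{0} (HVee H) where
  obj E := SemimoduleCat.of (HVee H) E.submodule
  map f := SemimoduleCat.ofHom (Hom.toLinearMap f)

/-- The set of affine functions on the polyhedron whose linear parts are fundamental weights. -/
def aff (E : ExtWeightPolyhedron H) : Set (E.carrier → HVee H) :=
  {f | IsFundAffine f}

/-- The `H_∨`-module of convex, piecewise-affine functions on the polyhedron whose linear parts are
fundamental weights. -/
def cpa (E : ExtWeightPolyhedron H) : Submodule (HVee H) (E.carrier → HVee H) where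
  carrier := {f | IsCPA f}
  add_mem' hf hg := hf.sup hg
  zero_mem' := IsCPA.bot
  smul_mem' a _ hf := hf.mul a

/-- The contravariant functor to `H_∨`-modules: functions on the polyhedron, with pullback. -/
def functionFunctor (H : AddSubgroup ℝ) :
    (ExtWeightPolyhedron H)ᵒᵖ ⥤ SemimoduleCat.{0} (HVee H) where
  obj E := SemimoduleCat.of (HVee H) E.unop.cpa
  map {E F} f := SemimoduleCat.ofHom
    { toFun := fun g => ⟨fun x => g.1 (f.unop.toFun x), g.2.comp f.unop.isCPA⟩
      map_add' := fun _ _ => rfl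
      map_smul' := fun _ _ => rfl }

/-- The pointwise maximum of two morphisms. -/
def Hom.sup {E F : ExtWeightPolyhedron H} (f g : E ⟶ F) : E ⟶ F where
  toFun x := ⟨(f.toFun x).1 + (g.toFun x).1, F.submodule.add_mem (f.toFun x).2 (g.toFun x).2⟩
  isCPA j := (f.isCPA j).sup (g.isCPA j)

/-- The morphism with constant value `-∞`. -/
def Hom.bot (E F : ExtWeightPolyhedron H) : E ⟶ F where
  toFun _ := ⟨0, F.submodule.zero_mem⟩
  isCPA _ := IsCPA.bot

/-- An affine map into a stratum of an extended polyhedron: some co-ordinates are constantly `-∞`,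
the others are affine functions whose linear parts are fundamental weights. -/
def Hom.IsAffine {E F : ExtWeightPolyhedron H} (f : E ⟶ F) : Prop :=
  ∀ j, (IsFundAffine fun x => (f.toFun x).1 j) ∨ ∀ x, (f.toFun x).1 j = ⊥

end ExtWeightPolyhedron

/-- The property of being a finite (that is, finitely generated) projective `H_∨`-module. -/
def isFiniteProjective (H : AddSubgroup ℝ) : ObjectProperty (SemimoduleCat.{0} (HVee H)) :=
  fun M => Module.Finite (HVee H) M ∧ Module.Projective (HVee H) M

end

/-! Everything reduces to max-plus matrices `R` with diagonal entries `1` and `R i j * R j k ≤ R i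
k` (`IsStar`). The inequalities defining a polyhedron can be closed up to such a star, because a
finite common point excludes cycles of positive weight; the polyhedron is then the module of
`potentials` of `R`. The star fixes these vectors, so they form a retract of the free module,
generated by the columns of `R`. Hence they are finite projective.

Conversely, a finite projective module is the image of an idempotent matrix `P`. By
`exists_diag_eq_one_of_idempotent`, the indices `k` with `P k k = 1` suffice to reconstruct this
image, and on them `P` restricts to a star.

Expanding a point in the columns shows that linear functionals and convex, piecewise-affine
functions coincide. This gives full faithfulness, the universal property and the decomposition into
affine maps. Functions on the potentials of `R` are the potentials of its transpose, so the dual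
statement follows in the same way. -/

/-! ### Order and cancellation in the max-plus semifield. -/

namespace HVee

variable {H : AddSubgroup ℝ}

instance : MulLeftMono (HVee H) := ⟨fun a _ _ h => mul_mono_right a h⟩

theorem of_mul_of_neg (c : H) : of c * of (-c) = 1 := by
  rw [of_mul_of, add_neg_cancel, one_def]

theorem of_neg_mul_of (c : H) : of (-c) * of c = 1 := by
  rw [mul_comm, of_mul_of_neg]

theorem of_neg_mul_le_iff (c : H) (x y : HVee H) : of (-c) * x ≤ y ↔ x ≤ of c * y := by
  constructor <;> intro h
  · simpa [← mul_assoc, of_mul_of_neg] using mul_mono_right (of c) h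
  · simpa [← mul_assoc, of_neg_mul_of] using mul_mono_right (of (-c)) h

theorem le_one_of_mul_le {a z : HVee H} (hz : z ≠ ⊥) (h : a * z ≤ z) : a ≤ 1 := by
  obtain rfl | ⟨c, rfl⟩ := eq_bot_or_of z
  · exact absurd rfl hz
  · rw [mul_comm] at h
    simpa [← mul_assoc, of_neg_mul_of] using mul_mono_right (of (-c)) h

theorem add_le_iff {a b c : HVee H} : a + b ≤ c ↔ a ≤ c ∧ b ≤ c := sup_le_iff

theorem le_add_left' (a b : HVee H) : a ≤ a + b := le_sup_left

theorem le_add_right' (a b : HVee H) : b ≤ a + b := le_sup_right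

theorem add_eq_right_iff {a b : HVee H} : a + b = b ↔ a ≤ b := sup_eq_right

theorem sum_le_iff {α : Type*} {s : Finset α} {f : α → HVee H} {b : HVee H} :
    ∑ i ∈ s, f i ≤ b ↔ ∀ i ∈ s, f i ≤ b := by
  rw [← sup_eq_sum, Finset.sup_le_iff]

theorem le_sum {α : Type*} {s : Finset α} (f : α → HVee H) {i : α} (hi : i ∈ s) :
    f i ≤ ∑ i ∈ s, f i := by
  rw [← sup_eq_sum]
  exact Finset.le_sup hi

theorem mul_ne_bot {a b : HVee H} : a * b ≠ ⊥ ↔ a ≠ ⊥ ∧ b ≠ ⊥ := by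
  obtain rfl | ⟨c, rfl⟩ := eq_bot_or_of a
  · simp [bot_mul]
  · obtain rfl | ⟨d, rfl⟩ := eq_bot_or_of b
    · simp [mul_comm _ (⊥ : HVee H), bot_mul]
    · simp [of_mul_of, of_ne_bot]

theorem mul_left_cancel_of_ne_bot {a b c : HVee H} (ha : a ≠ ⊥) (h : a * b = a * c) : b = c := by
  obtain rfl | ⟨d, rfl⟩ := eq_bot_or_of a
  · exact absurd rfl ha
  · simpa [← mul_assoc, of_neg_mul_of] using congrArg (of (-d) * ·) h

/-- If `H` is nonzero, then arbitrarily negative translates do not affect an upper bound. -/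
theorem le_of_forall_le_add (hH : H ≠ ⊥) {a b d : HVee H}
    (h : ∀ c : H, a ≤ b + of c * d) : a ≤ b := by
  by_contra hab
  have h' : ∀ c : H, a ≤ of c * d := fun c => (le_sup_iff.1 (h c)).resolve_left hab
  obtain rfl | ⟨a, rfl⟩ := eq_bot_or_of a
  · exact hab bot_le
  obtain rfl | ⟨d, rfl⟩ := eq_bot_or_of d
  · have := h' 0
    rw [mul_comm, bot_mul] at this
    exact of_ne_bot a (le_bot_iff.1 this)
  obtain ⟨e, he, hne⟩ := H.bot_or_exists_ne_zero.resolve_left hH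
  have key : ∀ c : H, a ≤ c + d := fun c => of_le_of.1 (by rw [of_add]; exact h' c)
  obtain ⟨n, hn⟩ := exists_nat_gt (((d : ℝ) - a) / |e|)
  have hpos : 0 < |e| := abs_pos.2 hne
  rw [div_lt_iff₀ hpos] at hn
  have habs : |e| ∈ H := by
    rcases abs_choice e with h | h <;> rw [h]
    exacts [he, H.neg_mem he]
  -- A nonzero `H` is unbounded below: `n` was chosen with `d - n|e| < a`.
  have := key ⟨-(n • |e|), H.neg_mem (H.nsmul_mem habs n)⟩
  have hreal : (a : ℝ) ≤ -(n • |e|) + d := this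
  rw [nsmul_eq_mul] at hreal
  linarith

end HVee

/-! ### Kleene stars, their potentials, and the corresponding polyhedra. -/

section Star

variable {H : AddSubgroup ℝ} {ι : Type}

/-- A max-plus matrix that is reflexive and transitive: it is its own Kleene star. -/
structure IsStar (R : ι → ι → HVee H) : Prop where
  diag : ∀ i, R i i = 1
  trans : ∀ i j k, R i j * R j k ≤ R i k

/-- The submodule of vectors `x` satisfying `R x ≤ x`. -/
def potentials (R : ι → ι → HVee H) : Submodule (HVee H) (ι → HVee H) where
  carrier := {x | ∀ j i, R j i * x i ≤ x j}
  add_mem' {x y} hx hy j i := by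
    rw [Pi.add_apply, Pi.add_apply, mul_add]
    exact sup_le_sup (hx j i) (hy j i)
  zero_mem' j i := by simp
  smul_mem' a x hx j i := by
    rw [Pi.smul_apply, Pi.smul_apply, smul_eq_mul, smul_eq_mul, mul_left_comm]
    exact HVee.mul_mono_right a (hx j i)

theorem mem_potentials {R : ι → ι → HVee H} {x : ι → HVee H} :
    x ∈ potentials R ↔ ∀ j i, R j i * x i ≤ x j := Iff.rfl

namespace IsStar

variable {R : ι → ι → HVee H}

theorem transpose (hR : IsStar R) : IsStar fun i j => R j i :=
  ⟨hR.diag, fun i j k => by rw [mul_comm]; exact hR.trans k j i⟩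

theorem col_mem (hR : IsStar R) (i : ι) : (fun j => R j i) ∈ potentials R :=
  fun j k => hR.trans j k i

/-- The diagonal term attains `x j`, and membership bounds the other terms. This makes `R` a
projector onto its potentials. -/
theorem sum_mul_eq [Fintype ι] (hR : IsStar R) {x : ι → HVee H} (hx : x ∈ potentials R) (j : ι) :
    ∑ i, R j i * x i = x j := by
  refine le_antisymm (HVee.sum_le_iff.2 fun i _ => hx j i) ?_
  have := HVee.le_sum (fun i => R j i * x i) (Finset.mem_univ j)
  simpa [hR.diag] using this

theorem sum_mul_mem [Fintype ι] (hR : IsStar R) (x : ι → HVee H) :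
    (fun j => ∑ i, R j i * x i) ∈ potentials R := by
  have : (fun j => ∑ i, R j i * x i) = ∑ i, x i • fun j => R j i := by
    ext j
    simp [mul_comm]
  rw [this]
  exact Submodule.sum_mem _ fun i _ => Submodule.smul_mem _ _ (hR.col_mem i)

/-- Imposing one more inequality `x p ≤ x q + c` on the potentials of a star gives the potentials
of another star, as long as some finite potential satisfies the inequality. -/
theorem exists_inf_extSet (hR : IsStar R) (r : RootHalfSpace H ι) {z : ι → HVee H}
    (hz : ∀ i, z i ≠ ⊥) (hzR : z ∈ potentials R) (hzr : z ∈ r.extSet) :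
    ∃ R' : ι → ι → HVee H, IsStar R' ∧ (potentials R' : Set _) = ↑(potentials R) ∩ r.extSet := by
  -- The new inequality is read as an extra edge of weight `d = -c` at the entry `(q, p)`.
  obtain ⟨d, hd⟩ : ∃ d : HVee H, r.extSet = {x | d * x r.i ≤ x r.j} :=
    ⟨HVee.of (-r.c), by simp only [HVee.of_neg_mul_le_iff]; rfl⟩
  rw [hd] at hzr ⊢
  generalize r.i = p, r.j = q at hzr ⊢
  rw [Set.mem_ofPred_eq] at hzr
  -- Cancelling the finite co-ordinate `z q` shows that no cycle through the new edge has positive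
  -- weight.
  have hcyc : d * R p q ≤ 1 := by
    refine HVee.le_one_of_mul_le (hz q) ?_
    rw [mul_assoc]
    exact (HVee.mul_mono_right d (hzR p q)).trans hzr
  have hloop : ∀ i, R i q * d * R p i ≤ 1 := fun i => by
    calc R i q * d * R p i = d * (R p i * R i q) := by ring
      _ ≤ d * R p q := HVee.mul_mono_right d (hR.trans p i q)
      _ ≤ 1 := hcyc
  -- An optimal path uses the new edge at most once; in the product below, the term using it twice
  -- is absorbed by `hcyc`.
  refine ⟨fun j i => R j i + R j q * d * R p i, ⟨fun i => ?_, fun i j k => ?_⟩, ?_⟩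
  · rw [hR.diag, add_comm, HVee.add_eq_right_iff]
    exact hloop i
  · have e : (R i j + R i q * d * R p j) * (R j k + R j q * d * R p k) =
        (R i j * R j k + (R i j * R j q) * d * R p k) +
        (R i q * d * (R p j * R j k) + R i q * d * R p k * (d * (R p j * R j q))) := by ring
    rw [e, HVee.add_le_iff, HVee.add_le_iff, HVee.add_le_iff]
    refine ⟨⟨(hR.trans i j k).trans (HVee.le_add_left' _ _), ?_⟩, ?_, ?_⟩ <;>
      refine le_trans ?_ (HVee.le_add_right' _ _)
    · gcongr
      exact hR.trans i j q
    · gcongr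
      exact hR.trans p j k
    · exact mul_le_of_le_one_right' ((HVee.mul_mono_right d (hR.trans p j q)).trans hcyc)
  · ext x
    constructor
    · intro hx
      refine ⟨fun j i => le_trans ?_ (hx j i), le_trans ?_ (hx q p)⟩
      · gcongr
        exact HVee.le_add_left' _ _
      · gcongr
        simpa [hR.diag] using HVee.le_add_right' (R q p) (R q q * d * R p p)
    · rintro ⟨hx, hxr⟩ j i
      rw [add_mul, HVee.add_le_iff]
      refine ⟨hx j i, ?_⟩
      calc R j q * d * R p i * x i = R j q * (d * (R p i * x i)) := by ring
        _ ≤ R j q * (d * x p) := by gcongr; exact hx p i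
        _ ≤ R j q * x q := by gcongr; exact hxr
        _ ≤ x j := hx j q

/-- The projection of the free module onto the potentials of a star. -/
noncomputable def proj [Fintype ι] (hR : IsStar R) : (ι → HVee H) →ₗ[HVee H] potentials R :=
  LinearMap.codRestrict _ (LinearMap.pi fun j => ∑ i, R j i • LinearMap.proj i) fun x => by
    simpa [LinearMap.pi] using! hR.sum_mul_mem x

theorem proj_comp_subtype [Fintype ι] (hR : IsStar R) :
    hR.proj.comp (potentials R).subtype = LinearMap.id := by
  ext x j
  simpa [proj] using hR.sum_mul_eq x.2 j

theorem finite_potentials [Fintype ι] (hR : IsStar R) :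
    Module.Finite (HVee H) (potentials R) :=
  Module.Finite.of_surjective hR.proj fun x => ⟨x.1, LinearMap.congr_fun hR.proj_comp_subtype x⟩

theorem projective_potentials [Fintype ι] (hR : IsStar R) :
    Module.Projective (HVee H) (potentials R) :=
  Module.Projective.of_split _ _ hR.proj_comp_subtype

end IsStar

/-- The potentials of the half-spaces with a common finite point are those of a star. -/
theorem exists_isStar_of_halfSpaces (S : Finset (RootHalfSpace H ι))
    (hS : (⋂ r ∈ S, r.set).Nonempty) :
    ∃ R : ι → ι → HVee H, IsStar R ∧ (potentials R : Set _) = ⋂ r ∈ S, r.extSet := by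
  classical
  obtain ⟨z, hz⟩ := hS
  have hz' : ∀ r ∈ S, (fun i => HVee.of (z i)) ∈ r.extSet := fun r hr => by
    have := Set.mem_iInter₂.1 hz r hr
    simp only [RootHalfSpace.set, RootHalfSpace.extSet, Set.mem_ofPred_eq, HVee.of_mul_of,
      HVee.of_le_of] at this ⊢
    exact sub_le_iff_le_add.1 this
  clear hz
  induction S using Finset.induction_on with
  | empty =>
    refine ⟨fun i j => if i = j then 1 else 0, ⟨fun i => if_pos rfl, fun i j k => ?_⟩, ?_⟩
    · by_cases h : i = j
      · simp [h]
      · simp only [h, if_false, zero_mul]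
        exact bot_le
    · ext x
      simp only [SetLike.mem_coe, mem_potentials, Finset.notMem_empty, Set.iInter_of_empty,
        Set.iInter_univ, Set.mem_univ, iff_true]
      intro j i
      by_cases h : j = i
      · simp [h]
      · simp only [h, if_false, zero_mul]
        exact bot_le
  | insert r S hr ih =>
    obtain ⟨R, hR, hRS⟩ := ih fun r hr => hz' r (Finset.mem_insert_of_mem hr)
    have hzR : (fun i => HVee.of (z i)) ∈ potentials R := by
      rw [← SetLike.mem_coe, hRS]
      exact Set.mem_iInter₂.2 fun r hr => hz' r (Finset.mem_insert_of_mem hr)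
    obtain ⟨R', hR', h⟩ := hR.exists_inf_extSet r (fun i => HVee.of_ne_bot _) hzR
      (hz' r (Finset.mem_insert_self _ _))
    exact ⟨R', hR', by rw [h, hRS, Finset.set_biInter_insert, Set.inter_comm]⟩

/-- The extended weight polyhedron of potentials of a star. -/
def IsStar.polyhedron [Finite ι] {R : ι → ι → HVee H} (hR : IsStar R) :
    ExtWeightPolyhedron H where
  ι := ι
  carrier := potentials R
  exists_halfSpaces := by
    have := Fintype.ofFinite ι
    -- One half-space is kept for each off-diagonal entry in `H`; an entry `-∞` imposes nothing.
    have hfin : {r : RootHalfSpace H ι | R r.j r.i = HVee.of (-r.c)}.Finite := by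
      refine Set.Finite.of_finite_image (f := fun r => (r.i, r.j)) (Set.toFinite _) ?_
      rintro ⟨i, j, h, c⟩ hc ⟨i', j', h', c'⟩ hc' e
      obtain ⟨rfl, rfl⟩ := Prod.mk.inj e
      have : HVee.of (-c) = HVee.of (-c') := hc.symm.trans hc'
      have : -c = -c' := WithBot.coe_injective this
      rw [neg_inj] at this
      subst this
      rfl
    refine ⟨hfin.toFinset, ?_, ?_⟩
    -- Projecting the origin of `H ^ ι` gives a finite potential: the unit diagonal keeps every
    -- co-ordinate away from `-∞`.
    · have hmem := hR.sum_mul_mem fun _ => 1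
      have hne : ∀ j, ∃ c : H, ∑ i, R j i * 1 = HVee.of c := fun j => by
        refine (HVee.eq_bot_or_of _).resolve_left fun h => ?_
        have := HVee.le_sum (fun i => R j i * 1) (Finset.mem_univ j)
        rw [h, hR.diag, mul_one] at this
        exact HVee.of_ne_bot 0 (le_bot_iff.1 this)
      choose z hz using hne
      refine ⟨z, Set.mem_iInter₂.2 fun r hr => ?_⟩
      have h := hmem r.j r.i
      simp only [hz] at h
      rw [(Set.Finite.mem_toFinset _).1 hr, HVee.of_neg_mul_le_iff, HVee.of_mul_of,
        HVee.of_le_of] at h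
      exact sub_le_iff_le_add.2 h
    · ext x
      simp only [SetLike.mem_coe, Set.mem_iInter, Set.Finite.mem_toFinset, Set.mem_ofPred_eq,
        RootHalfSpace.extSet, ← HVee.of_neg_mul_le_iff]
      constructor
      · intro hx r hr
        rw [← hr]
        exact hx _ _
      · intro hx j i
        rcases eq_or_ne i j with rfl | hij
        · rw [hR.diag, one_mul]
        · rcases HVee.eq_bot_or_of (R j i) with h | ⟨c, h⟩
          · rw [h, HVee.bot_mul]
            exact bot_le
          · have := hx ⟨i, j, hij, -c⟩ (by simpa using h)
            rwa [neg_neg, ← h] at this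

end Star

/-! ### Idempotent matrices and finite projective modules. -/

section Idempotent

variable {H : AddSubgroup ℝ} {α : Type} [Fintype α] {P : α → α → HVee H}

/-- Entries of an idempotent max-plus matrix factor through indices with diagonal entry one. -/
theorem exists_diag_eq_one_of_idempotent (hP : ∀ i k, ∑ j, P i j * P j k = P i k) (i j : α)
    (hij : P i j ≠ ⊥) : ∃ k, P k k = 1 ∧ P i j = P i k * P k j := by
  classical
  have htrans : ∀ a b c, P a b * P b c ≤ P a c := fun a b c => by
    rw [← hP a c]
    exact HVee.le_sum (fun b => P a b * P b c) (Finset.mem_univ b)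
  have hstep : ∀ k, P k j ≠ ⊥ → ∃ l, P k j = P k l * P l j := fun k hk => by
    obtain ⟨l, -, hl⟩ := Finset.exists_mem_eq_sup Finset.univ ⟨k, Finset.mem_univ k⟩
      fun l => P k l * P l j
    rw [HVee.sup_eq_sum, hP] at hl
    exact ⟨l, hl⟩
  have hcomp : ∀ a b c, P a j = P a b * P b j → P b j = P b c * P c j →
      P a j = P a c * P c j := fun a b c h1 h2 => by
    refine le_antisymm ?_ (htrans a c j)
    calc P a j = P a b * P b c * P c j := by rw [h1, h2, mul_assoc]
      _ ≤ P a c * P c j := by gcongr; exact htrans a b c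
  by_contra! hcon
  -- Intermediate indices of optimal factorisations, with `b` lying between `a` and `j`. Cancelling
  -- `P a j` shows that `r a a` forces `P a a = 1`. If this never occurs, `r` is well-founded on a
  -- finite type, yet `hstep` always provides a further predecessor.
  let r : α → α → Prop := fun b a => (P i j = P i a * P a j) ∧ P a j = P a b * P b j
  have hne : ∀ a, P i j = P i a * P a j → P a j ≠ ⊥ := fun a h =>
    (HVee.mul_ne_bot.1 (h ▸ hij)).2
  have : Std.Irrefl r := ⟨fun a ⟨h1, h2⟩ => by
    refine hcon a (HVee.mul_left_cancel_of_ne_bot (hne a h1) ?_) h1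
    rw [mul_one, mul_comm, ← h2]⟩
  have : IsTrans α r := ⟨fun a b c hab hbc => ⟨hbc.1, hcomp c b a hbc.2 hab.2⟩⟩
  have hwf : WellFounded r := Finite.wellFounded_of_trans_of_irrefl r
  have hno : ∀ a, P i j ≠ P i a * P a j := fun a => by
    induction a using hwf.induction with
    | _ a ih =>
      intro h
      obtain ⟨b, hb⟩ := hstep a (hne a h)
      exact ih b ⟨h, hb⟩ (hcomp i a b h hb)
  obtain ⟨l, hl⟩ := hstep i hij
  exact hno l hl

theorem isStar_of_idempotent (hP : ∀ i k, ∑ j, P i j * P j k = P i k) :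
    IsStar fun i j : {k // P k k = 1} => P i j :=
  ⟨fun i => i.2, fun i j k => by
    rw [← hP i k]
    exact HVee.le_sum (fun b => P i b * P b k) (Finset.mem_univ j.1)⟩

/-- Each term `P i j * x j` factors through some `k` with `P k k = 1`, and `P k j * x j ≤ x k`. So a
fixed vector is recovered from these co-ordinates alone. -/
theorem sum_subtype_of_idempotent [Fintype {k // P k k = 1}]
    (hP : ∀ i k, ∑ j, P i j * P j k = P i k) {x : α → HVee H}
    (hx : ∀ i, ∑ j, P i j * x j = x i) (i : α) :
    ∑ k : {k // P k k = 1}, P i k * x k = x i := by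
  apply le_antisymm
  · refine HVee.sum_le_iff.2 fun k _ => ?_
    rw [← hx i]
    exact HVee.le_sum (fun j => P i j * x j) (Finset.mem_univ k.1)
  · rw [← hx i]
    refine HVee.sum_le_iff.2 fun j _ => ?_
    by_cases hij : P i j = ⊥
    · rw [hij, HVee.bot_mul]
      exact bot_le
    · obtain ⟨k, hk, h⟩ := exists_diag_eq_one_of_idempotent hP i j hij
      refine le_trans ?_ (HVee.le_sum (fun k : {k // P k k = 1} => P i k * ∑ j, P k j * x j)
        (Finset.mem_univ ⟨k, hk⟩)) |>.trans_eq (by simp only [hx])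
      rw [h, mul_assoc]
      gcongr
      exact HVee.le_sum (fun j => P k j * x j) (Finset.mem_univ j)

/-- Every finite projective module over `H_∨` is the module of potentials of a star. -/
theorem exists_equiv_potentials (M : Type*) [AddCommMonoid M] [Module (HVee H) M]
    [Module.Finite (HVee H) M] [Module.Projective (HVee H) M] :
    ∃ (ι : Type) (_ : Finite ι) (R : ι → ι → HVee H),
      IsStar R ∧ Nonempty (M ≃ₗ[HVee H] potentials R) := by
  classical
  obtain ⟨n, p, s, -, -, hps⟩ := Module.Finite.exists_comp_eq_id_of_projective (HVee H) M
  -- The matrix of the idempotent `s ∘ p`, whose image is a copy of `M`.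
  let P : Fin n → Fin n → HVee H := fun i j => s (p (Pi.single j 1)) i
  have hsp : ∀ x i, s (p x) i = ∑ j, P i j * x j := fun x i => by
    conv_lhs => rw [← Finset.univ_sum_single x]
    rw [map_sum, map_sum, Finset.sum_apply]
    refine Finset.sum_congr rfl fun j _ => ?_
    have : Pi.single j (x j) = x j • (Pi.single j 1 : Fin n → HVee H) := by
      rw [← Pi.single_smul, smul_eq_mul, mul_one]
    rw [this, map_smul, map_smul, Pi.smul_apply, smul_eq_mul, mul_comm]
  have hid : ∀ m, p (s m) = m := LinearMap.congr_fun hps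
  have hP : ∀ i k, ∑ j, P i j * P j k = P i k := fun i k => by
    rw [← hsp (s (p (Pi.single k 1))), hid]
  have hfix : ∀ m i, ∑ j, P i j * s m j = s m i := fun m i => by rw [← hsp, hid]
  have hstar := isStar_of_idempotent hP
  have hmem : ∀ m, (LinearMap.funLeft (HVee H) (HVee H) Subtype.val).comp s m ∈
      potentials fun i j : {k // P k k = 1} => P i j := fun m j i => by
    change P j i * s m i ≤ s m j
    rw [← hfix m j]
    exact HVee.le_sum (fun i => P j i * s m i) (Finset.mem_univ i.1)
  refine ⟨{k // P k k = 1}, inferInstance, _, hstar, ⟨LinearEquiv.ofBijective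
    (LinearMap.codRestrict _ _ hmem) ⟨fun m m' h => ?_, fun y => ?_⟩⟩⟩
  · have h' : ∀ k : {k // P k k = 1}, s m k = s m' k := fun k => congrFun (congrArg Subtype.val h) k
    rw [← hid m, ← hid m']
    congr 1
    ext i
    rw [← sum_subtype_of_idempotent hP (hfix m), ← sum_subtype_of_idempotent hP (hfix m')]
    simp only [h']
  -- Extend `y` by `-∞` to the remaining indices and project.
  · refine ⟨p (∑ k, y.1 k • Pi.single k.1 1), Subtype.ext <| funext fun i => ?_⟩
    rw [← hstar.sum_mul_eq y.2 i]
    change s (p _) i = _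
    simp only [map_sum, map_smul, Finset.sum_apply, Pi.smul_apply, smul_eq_mul]
    exact Finset.sum_congr rfl fun k _ => mul_comm _ _

end Idempotent

/-! ### Generators of a polyhedron, and its functions as linear functionals. -/

namespace ExtWeightPolyhedron

variable {H : AddSubgroup ℝ}

noncomputable instance (E : ExtWeightPolyhedron H) : Fintype E.ι := Fintype.ofFinite _

theorem exists_star (E : ExtWeightPolyhedron H) :
    ∃ R : E.ι → E.ι → HVee H, IsStar R ∧ potentials R = E.submodule := by
  obtain ⟨S, hS, h⟩ := E.exists_halfSpaces
  obtain ⟨R, hR, hRS⟩ := exists_isStar_of_halfSpaces S hS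
  exact ⟨R, hR, SetLike.coe_injective (hRS.trans h.symm)⟩

/-- The star of an extended weight polyhedron. -/
noncomputable def star (E : ExtWeightPolyhedron H) : E.ι → E.ι → HVee H := E.exists_star.choose

theorem isStar_star (E : ExtWeightPolyhedron H) : IsStar E.star := E.exists_star.choose_spec.1

theorem potentials_star (E : ExtWeightPolyhedron H) : potentials E.star = E.submodule :=
  E.exists_star.choose_spec.2

theorem submodule_le {E : ExtWeightPolyhedron H} (x : E.submodule) (j i : E.ι) :
    E.star j i * x.1 i ≤ x.1 j :=
  (E.potentials_star.symm ▸ x.2 : x.1 ∈ potentials E.star) j i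

theorem submodule_le_iff {E : ExtWeightPolyhedron H} (x : E.ι → HVee H) :
    x ∈ E.submodule ↔ ∀ j i, E.star j i * x i ≤ x j := by
  rw [← potentials_star, mem_potentials]

/-- The generator of an extended weight polyhedron attached to a co-ordinate. -/
noncomputable def gen (E : ExtWeightPolyhedron H) (i : E.ι) : E.submodule :=
  ⟨fun j => E.star j i, E.potentials_star ▸ E.isStar_star.col_mem i⟩

theorem sum_smul_gen {E : ExtWeightPolyhedron H} (x : E.submodule) :
    ∑ i, x.1 i • E.gen i = x := by
  have hx : x.1 ∈ potentials E.star := E.potentials_star.symm ▸ x.2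
  ext j
  rw [← E.isStar_star.sum_mul_eq hx j]
  simp [gen, mul_comm]

theorem linearMap_apply {E : ExtWeightPolyhedron H} {X : Type*} [AddCommMonoid X]
    [Module (HVee H) X] (L : E.submodule →ₗ[HVee H] X) (x : E.submodule) :
    L x = ∑ i, x.1 i • L (E.gen i) := by
  conv_lhs => rw [← sum_smul_gen x]
  simp only [map_sum, map_smul]

theorem isCPA_sum {E : ExtWeightPolyhedron H} (a : E.ι → HVee H) :
    IsCPA fun x : E.carrier => ∑ i, a i * x.1 i := by
  simpa only [HVee.sup_eq_sum] using
    IsCPA.finset_sup Finset.univ fun i => (IsCPA.coord (D := E.carrier) i).mul (a i)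

theorem isCPA_linearMap {E : ExtWeightPolyhedron H} (L : E.submodule →ₗ[HVee H] HVee H) :
    IsCPA fun x : E.carrier => L x := by
  have h : (fun x : E.carrier => L x) = fun x : E.carrier => ∑ i, L (E.gen i) * x.1 i := by
    ext x
    rw [linearMap_apply L x]
    simp only [smul_eq_mul, mul_comm]
  rw [h]
  exact isCPA_sum _

/-- A convex, piecewise-affine function as a linear functional. -/
def toFunctional {E : ExtWeightPolyhedron H} {f : E.carrier → HVee H} (hf : IsCPA f) :
    E.submodule →ₗ[HVee H] HVee H where
  toFun := f
  map_add' x y := by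
    simpa using! hf.linear 1 1 x y (x + y : E.submodule) fun i => by rw [one_mul, one_mul]; rfl
  map_smul' a x := by
    simpa using! hf.linear a 0 x x (a • x : E.submodule) fun i => by rw [zero_mul, add_zero]; rfl

/-- By linearity, the values at the generators are canonical coefficients for `f`, although its
presentation as a maximum is not unique. -/
theorem cpa_apply {E : ExtWeightPolyhedron H} {f : E.carrier → HVee H} (hf : IsCPA f)
    (x : E.carrier) : f x = ∑ i, f (E.gen i) * x.1 i := by
  refine (linearMap_apply (toFunctional hf) x).trans (Finset.sum_congr rfl fun i _ => ?_)
  exact mul_comm _ _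

/-- The co-ordinate functions. -/
def coordCPA (E : ExtWeightPolyhedron H) (i : E.ι) : E.cpa := ⟨fun x => x.1 i, IsCPA.coord i⟩

theorem sum_smul_coordCPA {E : ExtWeightPolyhedron H} (f : E.cpa) :
    ∑ i, f.1 (E.gen i) • E.coordCPA i = f := by
  ext x
  rw [cpa_apply f.2 x]
  simp [coordCPA]

theorem linearMap_cpa_apply {E : ExtWeightPolyhedron H} {X : Type*} [AddCommMonoid X]
    [Module (HVee H) X] (L : E.cpa →ₗ[HVee H] X) (f : E.cpa) :
    L f = ∑ i, f.1 (E.gen i) • L (E.coordCPA i) := by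
  conv_lhs => rw [← sum_smul_coordCPA f]
  simp only [map_sum, map_smul]

/-- The order is encoded as `a + b = b` so that every linear map out of `E.cpa` preserves it. -/
theorem star_smul_coordCPA_le (E : ExtWeightPolyhedron H) (j i : E.ι) :
    E.star j i • E.coordCPA i + E.coordCPA j = E.coordCPA j := by
  ext x
  exact HVee.add_eq_right_iff.2 (submodule_le x j i)

/-- The convex, piecewise-affine functions are the potentials of the transposed star. -/
theorem exists_cpa_equiv {E : ExtWeightPolyhedron H} {R : E.ι → E.ι → HVee H} (hR : IsStar R)
    (hE : potentials R = E.submodule) :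
    Nonempty (E.cpa ≃ₗ[HVee H] potentials fun i j => R j i) := by
  have hcol : ∀ i, (fun j => R j i) ∈ E.submodule := fun i => hE ▸ hR.col_mem i
  have hsum : ∀ (L : E.submodule →ₗ[HVee H] HVee H) (x : E.submodule),
      L x = ∑ i, L ⟨_, hcol i⟩ * x.1 i := fun L x => by
    have hx : x = ∑ i, x.1 i • (⟨_, hcol i⟩ : E.submodule) := by
      have hx : x.1 ∈ potentials R := hE.symm ▸ x.2
      ext j
      rw [← hR.sum_mul_eq hx j]
      simp [mul_comm]
    conv_lhs => rw [hx]
    simp only [map_sum, map_smul, smul_eq_mul, mul_comm]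
  -- Evaluation at the columns of `R`; its inverse sends `a` to `∑ i, a i * x i`.
  let T : E.cpa →ₗ[HVee H] (E.ι → HVee H) :=
    { toFun := fun f i => f.1 ⟨_, hcol i⟩
      map_add' := fun _ _ => rfl
      map_smul' := fun _ _ => rfl }
  have hT : ∀ f, T f ∈ potentials fun i j => R j i := fun f j i => by
    change R i j * toFunctional f.2 ⟨_, hcol i⟩ ≤ toFunctional f.2 ⟨_, hcol j⟩
    rw [hsum (toFunctional f.2) ⟨_, hcol j⟩, mul_comm]
    exact HVee.le_sum (fun i => toFunctional f.2 ⟨_, hcol i⟩ * R i j) (Finset.mem_univ i)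
  refine ⟨LinearEquiv.ofBijective (T.codRestrict _ hT) ⟨fun f g h => ?_, fun a => ?_⟩⟩
  · have h' : ∀ i, toFunctional f.2 ⟨_, hcol i⟩ = toFunctional g.2 ⟨_, hcol i⟩ :=
      fun i => congrFun (congrArg Subtype.val h) i
    refine Subtype.ext (funext fun x => ?_)
    refine (hsum (toFunctional f.2) x).trans (Eq.trans ?_ (hsum (toFunctional g.2) x).symm)
    simp only [h']
  · refine ⟨⟨_, isCPA_sum a.1⟩, Subtype.ext <| funext fun j => ?_⟩
    rw [← hR.transpose.sum_mul_eq a.2 j]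
    exact Finset.sum_congr rfl fun i _ => mul_comm _ _

theorem isFiniteProjective_potentials {ι : Type} [Fintype ι] {R : ι → ι → HVee H}
    (hR : IsStar R) : isFiniteProjective H (SemimoduleCat.of (HVee H) (potentials R)) :=
  ⟨hR.finite_potentials, hR.projective_potentials⟩

theorem isFiniteProjective_of_equiv {M N : Type} [AddCommMonoid M] [AddCommMonoid N]
    [Module (HVee H) M] [Module (HVee H) N] (e : M ≃ₗ[HVee H] N)
    (h : isFiniteProjective H (SemimoduleCat.of (HVee H) N)) :
    isFiniteProjective H (SemimoduleCat.of (HVee H) M) := by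
  obtain ⟨h₁, h₂⟩ := h
  exact ⟨Module.Finite.equiv e.symm, Module.Projective.of_equiv e.symm⟩

theorem isFiniteProjective_moduleFunctor (E : ExtWeightPolyhedron H) :
    isFiniteProjective H ((moduleFunctor H).obj E) := by
  have := isFiniteProjective_potentials E.isStar_star
  rwa [potentials_star] at this

theorem isFiniteProjective_functionFunctor (E : (ExtWeightPolyhedron H)ᵒᵖ) :
    isFiniteProjective H ((functionFunctor H).obj E) := by
  obtain ⟨e⟩ := exists_cpa_equiv E.unop.isStar_star E.unop.potentials_star
  exact isFiniteProjective_of_equiv e (isFiniteProjective_potentials E.unop.isStar_star.transpose)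

/-! ### Full faithfulness and essential surjectivity. -/

instance : (moduleFunctor H).Faithful where
  map_injective {E F f g} h := by
    have h' := congrArg SemimoduleCat.Hom.hom h
    exact Hom.ext (funext fun x => LinearMap.congr_fun h' x)

instance : (moduleFunctor H).Full where
  map_surjective {_ F} L :=
    ⟨⟨fun x => L.hom x, fun j =>
      isCPA_linearMap (((LinearMap.proj j).comp F.submodule.subtype).comp L.hom)⟩, rfl⟩

instance : (functionFunctor H).Faithful where
  map_injective {E F f g} h := by
    have h' := congrArg SemimoduleCat.Hom.hom h
    refine Quiver.Hom.unop_inj (Hom.ext (funext fun x => Subtype.ext (funext fun j => ?_)))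
    exact congrFun (congrArg Subtype.val (LinearMap.congr_fun h' (E.unop.coordCPA j))) x

instance : (functionFunctor H).Full where
  map_surjective {E F} L := by
    let φ : E.unop.cpa →ₗ[HVee H] F.unop.cpa := L.hom
    -- The images of the co-ordinate functions must be the co-ordinates of the required map. Since
    -- `φ` preserves the star relations, the map lands in the polyhedron.
    have hmem : ∀ x : F.unop.carrier,
        (fun j => (φ (E.unop.coordCPA j)).1 x) ∈ E.unop.submodule := fun x => by
      rw [submodule_le_iff]
      intro j i
      have h := congrArg φ (E.unop.star_smul_coordCPA_le j i)
      rw [map_add, map_smul] at h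
      exact HVee.add_eq_right_iff.1 (congrFun (congrArg Subtype.val h) x)
    let f : F.unop ⟶ E.unop := ⟨fun x => ⟨_, hmem x⟩, fun j => (φ (E.unop.coordCPA j)).2⟩
    refine ⟨f.op, SemimoduleCat.hom_ext (LinearMap.ext fun g => ?_)⟩
    change _ = φ g
    rw [linearMap_cpa_apply φ g]
    refine Subtype.ext (funext fun x => ?_)
    refine (cpa_apply g.2 (f.toFun x)).trans ?_
    simp [f]

/-- By `exists_equiv_potentials`, realising the potentials of every star gives essential
surjectivity. -/
theorem exists_equivalence {C : Type*} [Category C] (F : C ⥤ SemimoduleCat.{0} (HVee H))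
    [F.Full] [F.Faithful] (hF : ∀ X, isFiniteProjective H (F.obj X))
    (hF' : ∀ (ι : Type) [Finite ι] (R : ι → ι → HVee H), IsStar R →
      ∃ X, Nonempty (F.obj X ≃ₗ[HVee H] potentials R)) :
    ∃ e : C ≌ (isFiniteProjective H).FullSubcategory,
      Nonempty (e.functor ⋙ (isFiniteProjective H).ι ≅ F) := by
  have : ((isFiniteProjective H).lift F hF).EssSurj := ⟨fun M => by
    obtain ⟨_, _⟩ := M.property
    obtain ⟨ι, _, R, hR, ⟨e⟩⟩ := exists_equiv_potentials (H := H) M.obj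
    obtain ⟨X, ⟨e'⟩⟩ := hF' ι R hR
    exact ⟨X, ⟨(isFiniteProjective H).isoMk (e'.trans e.symm).toModuleIsoₛ⟩⟩⟩
  have : ((isFiniteProjective H).lift F hF).IsEquivalence := { }
  exact ⟨((isFiniteProjective H).lift F hF).asEquivalence, ⟨Iso.refl _⟩⟩

/-- Passing to functions transposes the star, so the potentials of `R` are realised by the
polyhedron of its transpose. -/
theorem exists_function_equivalence (H : AddSubgroup ℝ) :
    ∃ e : (ExtWeightPolyhedron H)ᵒᵖ ≌ (isFiniteProjective H).FullSubcategory,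
      Nonempty (e.functor ⋙ (isFiniteProjective H).ι ≅ functionFunctor H) :=
  exists_equivalence _ isFiniteProjective_functionFunctor fun _ _ _ hR =>
    ⟨Opposite.op hR.transpose.polyhedron,
      exists_cpa_equiv (E := hR.transpose.polyhedron) hR.transpose (SetLike.coe_injective rfl)⟩

theorem exists_module_equivalence (H : AddSubgroup ℝ) :
    ∃ e : ExtWeightPolyhedron H ≌ (isFiniteProjective H).FullSubcategory,
      Nonempty (e.functor ⋙ (isFiniteProjective H).ι ≅ moduleFunctor H) :=
  exists_equivalence _ isFiniteProjective_moduleFunctor fun _ _ _ hR =>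
    ⟨hR.polyhedron, ⟨LinearEquiv.ofEq hR.polyhedron.submodule _ (SetLike.coe_injective rfl)⟩⟩

/-! ### Affine functions, affine maps, and compatibility with maxima. -/

theorem isFundAffine_coord (E : ExtWeightPolyhedron H) (i : E.ι) :
    IsFundAffine fun x : E.carrier => x.1 i :=
  ⟨i, 0, fun x => by rw [← HVee.one_def, one_mul]⟩

/-- The functions on a polyhedron form the free module on the partially ordered `H`-module of
affine functions. -/
theorem existsUnique_linearMap_cpa (E : ExtWeightPolyhedron H) (X : Type u) [AddCommMonoid X]
    [Module (HVee H) X] (φ : E.aff → X)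
    (hφ : ∀ (c : H) (f g : E.aff), g.1 = HVee.of c • f.1 → φ g = HVee.of c • φ f)
    (hmono : ∀ f g : E.aff, f.1 ≤ g.1 → φ f + φ g = φ g) :
    ∃! L : E.cpa →ₗ[HVee H] X, ∀ (f : E.cpa) (hf : f.1 ∈ E.aff), L f = φ ⟨f.1, hf⟩ := by
  classical
  let ψ : E.ι → X := fun i => φ ⟨_, E.isFundAffine_coord i⟩
  have hψ : ∀ j i, E.star j i • ψ i + ψ j = ψ j := fun j i => by
    obtain h | ⟨c, h⟩ := HVee.eq_bot_or_of (E.star j i)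
    · rw [h, ← HVee.zero_def, zero_smul, zero_add]
    · have hc : IsFundAffine (HVee.of c • fun x : E.carrier => x.1 i) := ⟨i, c, fun x => rfl⟩
      rw [h, ← hφ c ⟨_, E.isFundAffine_coord i⟩ ⟨_, hc⟩ rfl]
      refine hmono ⟨_, hc⟩ _ fun x => ?_
      have := submodule_le x j i
      rwa [h] at this
  have habs : ∀ (s : Finset E.ι) j, ∑ i ∈ s, E.star j i • ψ i + ψ j = ψ j := fun s j => by
    induction s using Finset.induction_on with
    | empty => simp
    | insert i s hi ih => rw [Finset.sum_insert hi, add_assoc, ih, hψ]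
  -- The diagonal term is `ψ j` and absorbs the others.
  have hsum : ∀ j, ∑ i, E.star j i • ψ i = ψ j := fun j => by
    have h := habs (Finset.univ.erase j) j
    conv_rhs at h => rw [← h]
    rw [← Finset.sum_erase_add _ _ (Finset.mem_univ j), E.isStar_star.diag, one_smul]
    exact habs _ j
  -- The canonical coefficients depend linearly on `f`, so no choice of presentation enters; `hsum`
  -- yields the prescribed values on affine functions.
  let L : E.cpa →ₗ[HVee H] X :=
    { toFun := fun f => ∑ i, f.1 (E.gen i) • ψ i
      map_add' := fun f g => by
        rw [← Finset.sum_add_distrib]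
        exact Finset.sum_congr rfl fun i _ => add_smul _ _ _
      map_smul' := fun a f => by
        rw [RingHom.id_apply, Finset.smul_sum]
        exact Finset.sum_congr rfl fun i _ => mul_smul _ _ _ }
  refine ⟨L, fun f hf => ?_, fun L' hL' => LinearMap.ext fun f => ?_⟩
  · obtain ⟨j, c, h⟩ := id hf
    rw [hφ c ⟨_, E.isFundAffine_coord j⟩ ⟨f.1, hf⟩ (funext h)]
    change _ = HVee.of c • ψ j
    rw [← hsum j, Finset.smul_sum]
    refine Finset.sum_congr rfl fun i _ => ?_
    exact (congrArg (· • ψ i) (h (E.gen i))).trans (mul_smul _ _ _)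
  · rw [linearMap_cpa_apply L']
    exact Finset.sum_congr rfl fun i _ => by
      rw [hL' (E.coordCPA i) (E.isFundAffine_coord i)]
      rfl

/-- Every morphism is a finite maximum of affine maps into strata. -/
theorem Hom.exists_finset_isAffine {E F : ExtWeightPolyhedron H} (f : E ⟶ F) :
    ∃ T : Finset (E ⟶ F), (∀ g ∈ T, Hom.IsAffine g) ∧
      ∀ x j, (f.toFun x).1 j = T.sup fun g => (g.toFun x).1 j := by
  classical
  -- The terms of `f x = ∑ i, x i • f (gen i)`; the `-∞` co-ordinates of `f (gen i)` determine the
  -- stratum.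
  let g : E.ι → (E ⟶ F) := fun i =>
    { toFun := fun x => ⟨_, F.submodule.smul_mem (x.1 i) (f.toFun (E.gen i)).2⟩
      isCPA := fun j => by
        simpa only [mul_comm] using!
          (IsCPA.coord (D := E.carrier) i).mul ((f.toFun (E.gen i)).1 j) }
  have hg : ∀ i x j, ((g i).toFun x).1 j = (f.toFun (E.gen i)).1 j * x.1 i :=
    fun i x j => mul_comm _ _
  refine ⟨Finset.univ.image g, fun h hh => ?_, fun x j => ?_⟩
  · obtain ⟨i, -, rfl⟩ := Finset.mem_image.1 hh
    intro j
    simp only [hg]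
    obtain h | ⟨c, h⟩ := HVee.eq_bot_or_of ((f.toFun (E.gen i)).1 j)
    · exact Or.inr fun x => by rw [h, HVee.bot_mul]
    · exact Or.inl ⟨i, c, fun x => by rw [h]⟩
  · rw [Finset.sup_image, HVee.sup_eq_sum, cpa_apply (f.isCPA j) x]
    exact Finset.sum_congr rfl fun i _ => (hg i x j).symm

/-- Pullback is additive in the morphism because the function pulled back is itself linear. -/
theorem functionFunctor_map_sup {E F : ExtWeightPolyhedron H} (f g : E ⟶ F) :
    ((functionFunctor H).map (Hom.sup f g).op).hom =
      ((functionFunctor H).map f.op).hom + ((functionFunctor H).map g.op).hom :=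
  LinearMap.ext fun u => Subtype.ext <| funext fun x =>
    (toFunctional u.2).map_add (f.toFun x) (g.toFun x)

theorem functionFunctor_map_bot (E F : ExtWeightPolyhedron H) :
    ((functionFunctor H).map (Hom.bot E F).op).hom = 0 :=
  LinearMap.ext fun u => Subtype.ext <| funext fun _ => (toFunctional u.2).map_zero

/-! ### Extension from the finite points when `H` is nonzero. -/

theorem exists_finite_point (E : ExtWeightPolyhedron H) : ∃ z : E.submodule, ∀ i, z.1 i ≠ ⊥ := by
  obtain ⟨S, ⟨z, hz⟩, h⟩ := E.exists_halfSpaces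
  refine ⟨⟨fun i => HVee.of (z i), ?_⟩, fun i => HVee.of_ne_bot _⟩
  change _ ∈ E.carrier
  rw [h]
  refine Set.mem_iInter₂.2 fun r hr => ?_
  have := Set.mem_iInter₂.1 hz r hr
  simp only [RootHalfSpace.set, RootHalfSpace.extSet, Set.mem_ofPred_eq, HVee.of_mul_of,
    HVee.of_le_of] at this ⊢
  exact sub_le_iff_le_add.1 this

/-- For nonzero `H`, an inequality between convex, piecewise-affine functions holds on the extended
polyhedron as soon as it holds at the finite points. -/
theorem cpa_le_of_finitePart (hH : H ≠ ⊥) {E : ExtWeightPolyhedron H} {f g : E.carrier → HVee H}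
    (hf : IsCPA f) (hg : IsCPA g) (h : ∀ x : E.carrier, (∀ i, x.1 i ≠ ⊥) → f x ≤ g x) : f ≤ g := by
  obtain ⟨z, hz⟩ := E.exists_finite_point
  intro x
  refine HVee.le_of_forall_le_add hH (d := g z) fun c => ?_
  let x' : E.submodule := x
  -- Joining `x` with a translate of a finite point gives a finite point; letting `c` tend to `-∞`
  -- removes the extra term.
  let y : E.submodule := x' + HVee.of c • z
  have hy : ∀ i, y.1 i ≠ ⊥ := fun i hi => by
    have h1 : HVee.of c * z.1 i ≤ y.1 i := HVee.le_add_right' (x'.1 i) _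
    rw [hi] at h1
    exact HVee.mul_ne_bot.2 ⟨HVee.of_ne_bot c, hz i⟩ (le_bot_iff.1 h1)
  have hfy : f y = f x + HVee.of c * f z :=
    (toFunctional hf).map_add x' _ |>.trans <|
      congrArg (f x + ·) ((toFunctional hf).map_smul (HVee.of c) z)
  have hgy : g y = g x + HVee.of c * g z :=
    (toFunctional hg).map_add x' _ |>.trans <|
      congrArg (g x + ·) ((toFunctional hg).map_smul (HVee.of c) z)
  exact (hfy ▸ HVee.le_add_left' _ _).trans ((h y hy).trans_eq hgy)

/-- For nonzero `H`, a morphism is the same as a map defined on the finite points. -/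
theorem existsUnique_hom_of_finitePart (hH : H ≠ ⊥) (E F : ExtWeightPolyhedron H)
    (f : E.finitePart → F.carrier) (hf : ∀ j, IsCPA fun x => (f x).1 j) :
    ∃! g : E ⟶ F, ∀ x : E.finitePart, g.toFun ⟨x.1, x.2.1⟩ = f x := by
  choose S hS using hf
  -- The same maxima are evaluated at infinite points too. Membership in `F` and uniqueness are
  -- inequalities between such functions, so they can be checked at finite points.
  let u : F.ι → E.carrier → HVee H := fun j x => (S j).sup fun s => HVee.of s.2 * x.1 s.1
  have hu : ∀ j, IsCPA (u j) := fun j => ⟨S j, fun _ => rfl⟩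
  have huf : ∀ (x : E.carrier) (hx : ∀ i, x.1 i ≠ ⊥) j, u j x = (f ⟨x.1, x.2, hx⟩).1 j :=
    fun x hx j => (hS j ⟨x.1, x.2, hx⟩).symm
  have hmem : ∀ x, (fun j => u j x) ∈ F.submodule := fun x => by
    rw [submodule_le_iff]
    intro j i
    refine cpa_le_of_finitePart hH ((hu i).mul (F.star j i)) (hu j) (fun x hx => ?_) x
    rw [huf x hx, huf x hx]
    exact submodule_le (f ⟨x.1, x.2, hx⟩) j i
  refine ⟨⟨fun x => ⟨_, hmem x⟩, hu⟩, fun x => Subtype.ext <| funext fun j =>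
    huf ⟨x.1, x.2.1⟩ x.2.2 j, fun g hg => Hom.ext <| funext fun x => Subtype.ext <|
      funext fun j => ?_⟩
  have heq : ∀ x : E.carrier, (∀ i, x.1 i ≠ ⊥) → (g.toFun x).1 j = u j x := fun x hx => by
    rw [huf x hx, ← hg]
  exact le_antisymm
    (cpa_le_of_finitePart hH (g.isCPA j) (hu j) (fun x hx => (heq x hx).le) x)
    (cpa_le_of_finitePart hH (hu j) (g.isCPA j) (fun x hx => (heq x hx).ge) x)

end ExtWeightPolyhedron


theorem mainTheorem2 (H : AddSubgroup ℝ) :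
    -- the anti-equivalence given by convex, piecewise-affine functions
    (∃ e : (ExtWeightPolyhedron H)ᵒᵖ ≌ (isFiniteProjective H).FullSubcategory,
      Nonempty (e.functor ⋙ (isFiniteProjective H).ι ≅ ExtWeightPolyhedron.functionFunctor H)) ∧
    -- the equivalence given by the polyhedra themselves
    (∃ e : ExtWeightPolyhedron H ≌ (isFiniteProjective H).FullSubcategory,
      Nonempty (e.functor ⋙ (isFiniteProjective H).ι ≅ ExtWeightPolyhedron.moduleFunctor H)) ∧
    -- the functions form the free module on the partially ordered `H`-module of affine functions
    (∀ (E : ExtWeightPolyhedron H) (X : Type u) [AddCommMonoid X] [Module (HVee H) X]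
      (φ : E.aff → X),
      (∀ (c : H) (f g : E.aff), g.1 = HVee.of c • f.1 → φ g = HVee.of c • φ f) →
      (∀ f g : E.aff, f.1 ≤ g.1 → φ f + φ g = φ g) →
      ∃! L : E.cpa →ₗ[HVee H] X,
        ∀ (f : E.cpa) (hf : f.1 ∈ E.aff), L f = φ ⟨f.1, hf⟩) ∧
    -- every morphism is a finite maximum of affine maps into strata
    (∀ (E F : ExtWeightPolyhedron H) (f : E ⟶ F), ∃ T : Finset (E ⟶ F),
      (∀ g ∈ T, ExtWeightPolyhedron.Hom.IsAffine g) ∧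
      ∀ x j, (f.toFun x).1 j = T.sup fun g => (g.toFun x).1 j) ∧
    -- the duality and the equivalence are linear for finite maxima of morphisms
    (∀ E F : ExtWeightPolyhedron H,
      (∀ f g : E ⟶ F,
        ((ExtWeightPolyhedron.functionFunctor H).map
            (ExtWeightPolyhedron.Hom.sup f g).op).hom =
          ((ExtWeightPolyhedron.functionFunctor H).map f.op).hom +
            ((ExtWeightPolyhedron.functionFunctor H).map g.op).hom ∧
        ((ExtWeightPolyhedron.moduleFunctor H).map
            (ExtWeightPolyhedron.Hom.sup f g)).hom =
          ((ExtWeightPolyhedron.moduleFunctor H).map f).hom +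
            ((ExtWeightPolyhedron.moduleFunctor H).map g).hom) ∧
      ((ExtWeightPolyhedron.functionFunctor H).map
        (ExtWeightPolyhedron.Hom.bot E F).op).hom = 0 ∧
      ((ExtWeightPolyhedron.moduleFunctor H).map (ExtWeightPolyhedron.Hom.bot E F)).hom = 0) ∧
    -- for nonzero `H`, a morphism is the same as a map defined on the finite points
    (H ≠ ⊥ → ∀ (E F : ExtWeightPolyhedron H) (f : E.finitePart → F.carrier),
      (∀ j, IsCPA fun x => (f x).1 j) →
      ∃! g : E ⟶ F, ∀ x : E.finitePart, g.toFun ⟨x.1, x.2.1⟩ = f x) :=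
  ⟨ExtWeightPolyhedron.exists_function_equivalence H,
    ExtWeightPolyhedron.exists_module_equivalence H,
    fun E X _ _ => ExtWeightPolyhedron.existsUnique_linearMap_cpa E X,
    fun _ _ => ExtWeightPolyhedron.Hom.exists_finset_isAffine,
    fun E F => ⟨fun f g => ⟨ExtWeightPolyhedron.functionFunctor_map_sup f g, rfl⟩,
      ExtWeightPolyhedron.functionFunctor_map_bot E F, rfl⟩,
    ExtWeightPolyhedron.existsUnique_hom_of_finitePart⟩
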